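/- Consider the Simple Growth model with attachment function $A_k=k+c$, where $c>0$. The networks $G_1,G_2,\dots$ are random finite directed multigraphs (loops and parallel edges allowed). $G_1$ consists of two isolated nodes. For $t\ge 1$, given $G_1,\dots,G_t$, the network $G_{t+1}$ arises from $G_t$ as follows: with probability $p(t)\in(0,1)$ (a deterministic number) a new isolated node is added; with probability $1-p(t)$ a new edge between existing nodes is added, whose destination is chosen among the nodes of $G_t$, a node of in-degree $k$ with probability proportional to $A_k$, and whose source is chosen among the nodes of $G_t$, independently of the destination, from an arbitrary distribution that may depend on $t$ and on the past. Let $N(t)$ be the number of nodes of $G_t$ and $n_k(t)$ the number of nodes of $G_t$ with in-degree $k$. Assume that $0<p<1$ and $p(t)=p+O(t^{-1/2}\log t)$ as $t\to\infty$. Put $\lambda = 1+\frac{cp}{1-p}$ and $$\pi_0=\frac{1+(c-1)p}{1-p+c},\qquad \pi_k=\frac{\lambda}{\lambda+k+c}\prod_{j=0}^{k-1}\frac{j+c}{\lambda+j+c}\quad(k\ge1).$$ Then for each fixed $k\ge 0$, as $t\to\infty$, with probability $1$, $$\frac{n_k(t)}{pt}\to\pi_k\qquad\text{and}\qquad \frac{n_k(t)}{N(t)}\to\pi_k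 .$$ Moreover, $\pi_k\ge 0$ for all $k$ and $\sum_{k\ge0}\pi_k=1$, so that the $\pi_k$ form the asymptotic in-degree distribution. It has a power-law tail with exponent $1+\lambda$: $$\lim_{k\to\infty}\frac{\pi_k}{k^{-(1+\lambda)}}=\frac{\lambda\,\Gamma(\lambda+c)}{\Gamma(c)} .$$ -/

import Mathlib

open Filter Topology MeasureTheory ProbabilityTheory Asymptotics

namespace SimpleGrowth

/-- A finite directed multigraph (loops and parallel edges allowed). The nodes are
`0, …, numNodes - 1`, and an edge is a pair `(source, destination)`. -/
structure Network where
  numNodes : ℕ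
  edges : Multiset (Fin numNodes × Fin numNodes)

namespace Network

/-- There are only countably many networks; events about a network are arbitrary sets of networks. -/
instance : MeasurableSpace Network := ⊤

/-- Two isolated nodes. -/
def initial : Network := ⟨2, 0⟩

/-- Add a new isolated node. -/
def addNode (g : Network) : Network :=
  ⟨g.numNodes + 1, g.edges.map (Prod.map Fin.castSucc Fin.castSucc)⟩

/-- Add a new edge from the existing node `u` to the existing node `v`. -/
def addEdge (g : Network) (u v : Fin g.numNodes) : Network :=
  ⟨g.numNodes, (u, v) ::ₘ g.edges⟩

/-- In-degree of the node `v`: the number of edges with destination `v`. -/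
def inDegree (g : Network) (v : Fin g.numNodes) : ℕ :=
  (g.edges.map Prod.snd).count v

/-- `n_k`: the number of nodes of in-degree `k`. -/
def degreeCount (g : Network) (k : ℕ) : ℕ :=
  (Finset.univ.filter fun v : Fin g.numNodes => g.inDegree v = k).card

/-- Normalizing factor: the total attachment value of all nodes, equal to `∑ k, n_k * A k`. -/
noncomputable def totalAttachment (A : ℕ → ℝ) (g : Network) : ℝ :=
  ∑ v : Fin g.numNodes, A (g.inDegree v)

end Network

/-- The event that the networks at times `1, …, t` are `g 1, …, g t`. -/
def history {Ω : Type*} (G : ℕ → Ω → Network) (t : ℕ) (g : ℕ → Network) : Set Ω :=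
  {ω | ∀ s ∈ Finset.Icc 1 t, G s ω = g s}

/-- `G 1, G 2, …` is a Simple Growth network process on the probability space `(Ω, μ)` with
attachment function `A` and new-node probabilities `p 1, p 2, …` (the value `G 0` plays no role).
It starts at time `1` with two isolated nodes. Given the past `G 1, …, G t`, the network `G (t + 1)`
arises from `G t` by adding a new isolated node with probability `p t`, and otherwise by adding an
edge between existing nodes, whose destination `v` is chosen with probability proportional to
`A (in-degree of v)` and, independently of it, whose source is chosen from some
unspecified distribution `q`, which may depend on `t` and on the past. -/
structure IsProcess {Ω : Type*} [MeasurableSpace Ω] (μ : Measure Ω)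
    (A : ℕ → ℝ) (p : ℕ → ℝ) (G : ℕ → Ω → Network) : Prop where
  measurable : ∀ t, Measurable (G t)
  start : ∀ᵐ ω ∂μ, G 1 ω = Network.initial
  node_step : ∀ t, 1 ≤ t → ∀ g : ℕ → Network, μ (history G t g) ≠ 0 →
    (cond μ (history G t g)).real {ω | G (t + 1) ω = (g t).addNode} = p t
  edge_step : ∀ t, 1 ≤ t → ∀ g : ℕ → Network, μ (history G t g) ≠ 0 →
    ∃ q : PMF (Fin (g t).numNodes), ∀ u v : Fin (g t).numNodes,
      (cond μ (history G t g)).real {ω | G (t + 1) ω = (g t).addEdge u v} =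
        (1 - p t) * ((q u).toReal * (A ((g t).inDegree v) / (g t).totalAttachment A))

/-- `λ = 1 + c p / (1 - p)`. -/
noncomputable def rate (p c : ℝ) : ℝ := 1 + c * p / (1 - p)

/-- The limiting degree distribution `π_k`. -/
noncomputable def limitDegree (p c : ℝ) (k : ℕ) : ℝ :=
  if k = 0 then (1 + (c - 1) * p) / (1 - p + c)
  else rate p c / (rate p c + k + c) *
    ∏ j ∈ Finset.range k, ((j + c) / (rate p c + j + c))

end SimpleGrowth

/-!
Write `N` and `n_k` for the numbers of nodes and of nodes of in-degree `k`, and `W` for the total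
attachment value. For the attachment function `k + c` one has `W = (number of edges) + c N`, and
nodes and edges together number `t + 1` at time `t`. So once `N / t → p` is known, `W / t` tends to
`1 - p + c p = (1 - p) λ`.

Given the past, the expected change of `n_k` in one step is an explicit drift: the inflow
`p(t)` (for `k = 0`) or `(1 - p(t)) (k - 1 + c) n_{k-1} / W` (for `k ≥ 1`), minus the outflow
`(1 - p(t)) (k + c) n_k / W`. The sum of the differences between true and expected changes is a
martingale with bounded increments. Its second moment is `O(t)`, so the second moments of its
averages are summable along the squares, and it is `o(t)` almost surely
(`ae_tendsto_sum_div_of_orthogonal`, `ae_tendsto_sum_sub_drift`). As there are only countably many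
histories, conditional expectations are handled by splitting `Ω` into the events `history G t g`.

On almost every sample path `n_k` therefore satisfies a noisy linear recursion
`u (t + 1) = u t + α t - β t * (u t / t) + noise` with convergent coefficients, and
`tendsto_div_of_recursion` gives `u t / t → (lim α) / (1 + lim β)`. By induction on `k`, this limit
is `p π_k`, since the `π_k` solve the same stationarity equations (`limitDegree_zero_eq`,
`limitDegree_succ_eq`).

The statements about `π_k` come from `P_k = ∏_{j < k} (j + c) / (λ + j + c)`: the identity
`π_k = P_k - P_{k+1}` makes the sum telescope, and Euler's product for the Gamma function gives the
asymptotics of `P_k`.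
-/

namespace SimpleGrowth

/-! ### The limiting distribution -/

/-- The tail `∑_{j ≥ k} π_j` of the limiting distribution, as a product; here `l` is the rate
`λ`. -/
noncomputable def tailProd (l c : ℝ) (k : ℕ) : ℝ :=
  ∏ j ∈ Finset.range k, ((j + c) / (l + j + c))

theorem tailProd_succ (l c : ℝ) (k : ℕ) :
    tailProd l c (k + 1) = tailProd l c k * ((k + c) / (l + k + c)) :=
  Finset.prod_range_succ _ _

theorem tailProd_nonneg {l c : ℝ} (hl : 0 < l) (hc : 0 < c) (k : ℕ) : 0 ≤ tailProd l c k :=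
  Finset.prod_nonneg fun _ _ => by positivity

theorem rate_pos {p c : ℝ} (hc : 0 < c) (hp0 : 0 < p) (hp1 : p < 1) : 0 < rate p c := by
  have : 0 < 1 - p := by linarith
  unfold rate; positivity

/-- The separate formula for `π_0` in `limitDegree` agrees with the general one, in which the
product is then empty. -/
theorem limitDegree_eq {p c : ℝ} (hc : 0 < c) (hp0 : 0 < p) (hp1 : p < 1) (k : ℕ) :
    limitDegree p c k = rate p c / (rate p c + k + c) * tailProd (rate p c) c k := by
  have h1 : 0 < 1 - p := by linarith
  rcases Nat.eq_zero_or_pos k with rfl | hk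
  · have h2 : 1 - p + c * p + c * (1 - p) ≠ 0 := by positivity
    have h3 : rate p c * (1 - p) = 1 - p + c * p := by unfold rate; field_simp
    have h4 : 0 < rate p c := rate_pos hc hp0 hp1
    simp only [limitDegree, tailProd, if_true, Finset.range_zero, Finset.prod_empty,
      Nat.cast_zero, mul_one, add_zero]
    rw [div_eq_div_iff (by positivity) (by positivity)]
    linear_combination -c * h3
  · simp only [limitDegree, tailProd, if_neg hk.ne']

theorem limitDegree_eq_sub {p c : ℝ} (hc : 0 < c) (hp0 : 0 < p) (hp1 : p < 1) (k : ℕ) :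
    limitDegree p c k = tailProd (rate p c) c k - tailProd (rate p c) c (k + 1) := by
  have h4 : 0 < rate p c := rate_pos hc hp0 hp1
  rw [limitDegree_eq hc hp0 hp1, tailProd_succ]
  field_simp
  ring

theorem limitDegree_eq_tailProd_succ {p c : ℝ} (hc : 0 < c) (hp0 : 0 < p) (hp1 : p < 1) (k : ℕ) :
    limitDegree p c k = rate p c / (k + c) * tailProd (rate p c) c (k + 1) := by
  have h4 : 0 < rate p c := rate_pos hc hp0 hp1
  rw [limitDegree_eq hc hp0 hp1, tailProd_succ]
  field_simp

theorem limitDegree_nonneg {p c : ℝ} (hc : 0 < c) (hp0 : 0 < p) (hp1 : p < 1) (k : ℕ) :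
    0 ≤ limitDegree p c k := by
  have h4 : 0 < rate p c := rate_pos hc hp0 hp1
  rw [limitDegree_eq hc hp0 hp1]
  exact mul_nonneg (by positivity) (tailProd_nonneg h4 hc k)

/-- `π_0` as the fixed point of the averaged dynamics: new nodes against lost nodes of in-degree
`0`. -/
theorem limitDegree_zero_eq {p c : ℝ} (hc : 0 < c) (hp0 : 0 < p) (hp1 : p < 1) :
    p * limitDegree p c 0 = p / (1 + c / rate p c) := by
  have h4 : 0 < rate p c := rate_pos hc hp0 hp1
  rw [limitDegree_eq hc hp0 hp1]
  simp only [tailProd, Finset.range_zero, Finset.prod_empty, Nat.cast_zero]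
  field_simp
  ring

/-- `π_{k+1}` as the fixed point of the averaged dynamics, given `π_k`. -/
theorem limitDegree_succ_eq {p c : ℝ} (hc : 0 < c) (hp0 : 0 < p) (hp1 : p < 1) (k : ℕ) :
    p * limitDegree p c (k + 1) = (k + c) / rate p c * (p * limitDegree p c k) /
      (1 + ((k + 1 : ℕ) + c) / rate p c) := by
  have h4 : 0 < rate p c := rate_pos hc hp0 hp1
  rw [limitDegree_eq hc hp0 hp1, limitDegree_eq hc hp0 hp1, tailProd_succ]
  push_cast
  have h5 : rate p c + (k + 1 + c) ≠ 0 := by positivity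
  field_simp
  ring

/-- Euler's product for the Gamma function gives `∏_{j ≤ n} (j + c) / (λ + j + c) ~
n ^ (-λ) Γ(λ + c) / Γ(c)`. -/
theorem tendsto_tailProd_mul_rpow {l c : ℝ} (hl : 0 < l) (hc : 0 < c) :
    Tendsto (fun n : ℕ => tailProd l c (n + 1) * (n : ℝ) ^ l) atTop
      (𝓝 (Real.Gamma (l + c) / Real.Gamma c)) := by
  refine ((Real.GammaSeq_tendsto_Gamma (l + c)).div (Real.GammaSeq_tendsto_Gamma c)
    (Real.Gamma_pos_of_pos hc).ne').congr' ?_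
  filter_upwards [eventually_gt_atTop 0] with n hn
  have hn' : (0 : ℝ) < n := by exact_mod_cast hn
  have e1 : ∏ j ∈ Finset.range (n + 1), (l + c + (j : ℝ)) ≠ 0 :=
    Finset.prod_ne_zero_iff.mpr fun j _ => by positivity
  have e2 : ∏ j ∈ Finset.range (n + 1), (c + (j : ℝ)) ≠ 0 :=
    Finset.prod_ne_zero_iff.mpr fun j _ => by positivity
  have e3 : tailProd l c (n + 1) =
      (∏ j ∈ Finset.range (n + 1), (c + (j : ℝ))) /
        ∏ j ∈ Finset.range (n + 1), (l + c + (j : ℝ)) := by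
    rw [tailProd, ← Finset.prod_div_distrib]
    exact Finset.prod_congr rfl fun j _ => by ring
  have e4 : (n : ℝ) ^ c ≠ 0 := (Real.rpow_pos_of_pos hn' c).ne'
  have e5 : ((n.factorial : ℕ) : ℝ) ≠ 0 := by positivity
  simp only [Pi.div_apply, Real.GammaSeq]
  rw [e3, Real.rpow_add hn']
  field_simp

theorem tendsto_tailProd {l c : ℝ} (hl : 0 < l) (hc : 0 < c) :
    Tendsto (tailProd l c) atTop (𝓝 0) := by
  rw [← tendsto_add_atTop_iff_nat 1]
  have h1 : Tendsto (fun n : ℕ => (n : ℝ) ^ (-l)) atTop (𝓝 0) :=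
    (tendsto_rpow_neg_atTop hl).comp tendsto_natCast_atTop_atTop
  have h2 := (tendsto_tailProd_mul_rpow hl hc).mul h1
  rw [mul_zero] at h2
  refine h2.congr' ?_
  filter_upwards [eventually_gt_atTop 0] with n hn
  have hn' : (0 : ℝ) < n := by exact_mod_cast hn
  rw [mul_assoc, ← Real.rpow_add hn', add_neg_cancel, Real.rpow_zero, mul_one]

theorem hasSum_limitDegree {p c : ℝ} (hc : 0 < c) (hp0 : 0 < p) (hp1 : p < 1) :
    HasSum (limitDegree p c) 1 := by
  rw [hasSum_iff_tendsto_nat_of_nonneg (limitDegree_nonneg hc hp0 hp1)]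
  have h1 : ∀ n, ∑ i ∈ Finset.range n, limitDegree p c i = 1 - tailProd (rate p c) c n := by
    intro n
    rw [Finset.sum_congr rfl fun i _ => limitDegree_eq_sub hc hp0 hp1 i, Finset.sum_range_sub']
    simp [tailProd]
  simp only [h1]
  simpa using (tendsto_tailProd (rate_pos hc hp0 hp1) hc).const_sub 1

theorem tendsto_limitDegree_div_rpow {p c : ℝ} (hc : 0 < c) (hp0 : 0 < p) (hp1 : p < 1) :
    Tendsto (fun k : ℕ => limitDegree p c k / (k : ℝ) ^ (-(1 + rate p c))) atTop
      (𝓝 (rate p c * Real.Gamma (rate p c + c) / Real.Gamma c)) := by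
  have hl : 0 < rate p c := rate_pos hc hp0 hp1
  have h1 : Tendsto (fun k : ℕ => (k : ℝ) / (k + c)) atTop (𝓝 1) :=
    tendsto_natCast_div_add_atTop c
  have h2 := (h1.mul (tendsto_tailProd_mul_rpow hl hc)).const_mul (rate p c)
  rw [one_mul, ← mul_div_assoc] at h2
  refine h2.congr' ?_
  filter_upwards [eventually_gt_atTop 0] with n hn
  have hn' : (0 : ℝ) < n := by exact_mod_cast hn
  rw [limitDegree_eq_tailProd_succ hc hp0 hp1, Real.rpow_neg hn'.le, div_inv_eq_mul,
    Real.rpow_add hn', Real.rpow_one]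
  ring

/-! ### A deterministic recursion -/

/-- If `|w|` grows at each step by at most a null sequence, then `w` is sublinear. -/
theorem tendsto_div_of_abs_succ_le {w ε : ℕ → ℝ} (hε : Tendsto ε atTop (𝓝 0))
    (h : ∀ᶠ n in atTop, |w (n + 1)| ≤ |w n| + ε n) :
    Tendsto (fun n : ℕ => w n / n) atTop (𝓝 0) := by
  set δ : ℕ → ℝ := fun n => max (|w (n + 1)| - |w n|) 0 with hδ
  have hδ0 : Tendsto δ atTop (𝓝 0) := by
    have hε' : Tendsto (fun n => |ε n|) atTop (𝓝 0) := by simpa using hε.abs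
    refine tendsto_of_tendsto_of_tendsto_of_le_of_le' tendsto_const_nhds hε'
      (Eventually.of_forall fun n => le_max_right _ _) ?_
    filter_upwards [h] with n hn
    exact max_le (by linarith [le_abs_self (ε n)]) (abs_nonneg _)
  have hle : ∀ n, |w n| ≤ |w 0| + ∑ i ∈ Finset.range n, δ i := by
    intro n
    induction n with
    | zero => simp
    | succ n ih =>
      rw [Finset.sum_range_succ]
      have := le_max_left (|w (n + 1)| - |w n|) 0
      simp only [hδ] at ih ⊢
      linarith
  have h1 : Tendsto (fun n : ℕ => |w 0| / (n : ℝ) + (n : ℝ)⁻¹ * ∑ i ∈ Finset.range n, δ i)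
      atTop (𝓝 0) := by
    simpa using (tendsto_const_div_atTop_nhds_zero_nat |w 0|).add hδ0.cesaro
  refine squeeze_zero_norm (fun n => ?_) h1
  rw [Real.norm_eq_abs, abs_div, Nat.abs_cast, div_eq_mul_inv, div_eq_mul_inv,
    mul_comm (n : ℝ)⁻¹, ← add_mul]
  exact mul_le_mul_of_nonneg_right (hle n) (by positivity)

/-- A noisy linear recursion `u (n+1) = u n + α n - β n * u n / (n+1) + x n` whose coefficients
converge and whose noise averages out has linear growth, with the slope `a / (1 + b)` at which the
noiseless recursion is stationary. -/
theorem tendsto_div_of_recursion {u α β x : ℕ → ℝ} {a b : ℝ}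
    (hrec : ∀ n, u (n + 1) = u n + α n - β n * (u n / (n + 1)) + x n)
    (hα : Tendsto α atTop (𝓝 a)) (hβ : Tendsto β atTop (𝓝 b)) (hβ0 : ∀ n, 0 ≤ β n)
    (hx : Tendsto (fun n : ℕ => (∑ i ∈ Finset.range n, x i) / n) atTop (𝓝 0)) :
    Tendsto (fun n : ℕ => u n / (n + 1)) atTop (𝓝 (a / (1 + b))) := by
  have hb : 0 ≤ b := ge_of_tendsto' hβ hβ0
  set L := a / (1 + b) with hL
  have hLb : a - b * L - L = 0 := by rw [hL]; field_simp; ring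
  set S : ℕ → ℝ := fun n => ∑ i ∈ Finset.range n, x i with hS
  have hr : Tendsto (fun n : ℕ => (n : ℝ) / (n + 1)) atTop (𝓝 1) :=
    tendsto_natCast_div_add_atTop 1
  have hx' : Tendsto (fun n : ℕ => S n / (n + 1)) atTop (𝓝 0) := by
    have := hx.mul hr
    rw [zero_mul] at this
    refine this.congr' ?_
    filter_upwards [eventually_gt_atTop 0] with n hn
    have : (n : ℝ) ≠ 0 := by exact_mod_cast hn.ne'
    field_simp
    rfl
  -- the deviation from the line of slope `L`, with the accumulated noise removed
  set w : ℕ → ℝ := fun n => u n - S n - (n + 1) * L with hw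
  set ε : ℕ → ℝ := fun n => α n - β n * (S n / (n + 1)) - β n * L - L with hε
  have hε0 : Tendsto ε atTop (𝓝 0) := by
    have := ((hα.sub (hβ.mul hx')).sub (hβ.mul_const L)).sub_const L
    rwa [mul_zero, sub_zero, hLb] at this
  have hwrec : ∀ n, w (n + 1) = w n * (1 - β n / (n + 1)) + ε n := by
    intro n
    have : (n : ℝ) + 1 ≠ 0 := by positivity
    simp only [hw, hε, hS, hrec n, Finset.sum_range_succ]
    push_cast
    field_simp
    ring
  have hβ1 : Tendsto (fun n : ℕ => β n / (n + 1)) atTop (𝓝 0) := by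
    have := hβ.mul (tendsto_one_div_add_atTop_nhds_zero_nat (𝕜 := ℝ))
    simpa [div_eq_mul_inv] using this
  have hwl : Tendsto (fun n : ℕ => w n / n) atTop (𝓝 0) := by
    refine tendsto_div_of_abs_succ_le (ε := fun n => |ε n|) (by simpa using hε0.abs) ?_
    filter_upwards [hβ1.eventually (gt_mem_nhds one_pos)] with n hn
    have h0 : 0 ≤ β n / (n + 1) := div_nonneg (hβ0 n) (by positivity)
    rw [hwrec]
    refine (abs_add_le _ _).trans (add_le_add ?_ le_rfl)
    rw [abs_mul, abs_of_nonneg (by linarith : 0 ≤ 1 - β n / (n + 1))]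
    exact mul_le_of_le_one_right (abs_nonneg _) (by linarith)
  have h3 := ((hwl.mul hr).add hx').add_const L
  rw [zero_mul, zero_add, zero_add] at h3
  refine h3.congr' ?_
  filter_upwards [eventually_gt_atTop 0] with n hn
  have : (n : ℝ) ≠ 0 := by exact_mod_cast hn.ne'
  have : (n : ℝ) + 1 ≠ 0 := by positivity
  simp only [hw]
  field_simp
  ring

/-! ### A strong law for bounded orthogonal increments -/

section StrongLaw

variable {Ω : Type*} [MeasurableSpace Ω] {μ : Measure Ω}

theorem integrable_of_ae_abs_le [IsProbabilityMeasure μ] {f : Ω → ℝ} (hf : Measurable f)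
    {C : ℝ} (hC : ∀ᵐ ω ∂μ, |f ω| ≤ C) : Integrable f μ :=
  Integrable.of_bound hf.aestronglyMeasurable C hC

theorem ae_abs_sum_range_le {X : ℕ → Ω → ℝ} {C : ℝ} (hC : ∀ n, ∀ᵐ ω ∂μ, |X n ω| ≤ C) (n : ℕ) :
    ∀ᵐ ω ∂μ, |∑ i ∈ Finset.range n, X i ω| ≤ n * C := by
  filter_upwards [ae_all_iff.mpr hC] with ω h
  calc |∑ i ∈ Finset.range n, X i ω| ≤ ∑ i ∈ Finset.range n, |X i ω| :=
        Finset.abs_sum_le_sum_abs _ _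
    _ ≤ ∑ _i ∈ Finset.range n, C := Finset.sum_le_sum fun i _ => h i
    _ = n * C := by simp

theorem ae_abs_sum_range_mul_le {X : ℕ → Ω → ℝ} {C : ℝ} (hC : ∀ n, ∀ᵐ ω ∂μ, |X n ω| ≤ C)
    (n : ℕ) : ∀ᵐ ω ∂μ, |(∑ i ∈ Finset.range n, X i ω) * X n ω| ≤ n * C * C := by
  filter_upwards [ae_abs_sum_range_le hC n, hC n] with ω h1 h2
  rw [abs_mul]
  exact mul_le_mul h1 h2 (abs_nonneg _) ((abs_nonneg _).trans h1)

/-- Pythagoras: the second moment of a sum of bounded orthogonal increments grows at most linearly. -/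
theorem integral_sq_sum_range_le [IsProbabilityMeasure μ] {X : ℕ → Ω → ℝ}
    (hX : ∀ n, Measurable (X n)) {C : ℝ}
    (hC : ∀ n, ∀ᵐ ω ∂μ, |X n ω| ≤ C)
    (horth : ∀ n, ∫ ω, (∑ i ∈ Finset.range n, X i ω) * X n ω ∂μ = 0) (n : ℕ) :
    ∫ ω, (∑ i ∈ Finset.range n, X i ω) ^ 2 ∂μ ≤ n * C ^ 2 := by
  have hS : ∀ n, Measurable fun ω => ∑ i ∈ Finset.range n, X i ω := fun n =>
    Finset.measurable_fun_sum _ fun i _ => hX i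
  induction n with
  | zero => simp
  | succ n ih =>
    have i1 : Integrable (fun ω => (∑ i ∈ Finset.range n, X i ω) ^ 2) μ := by
      refine integrable_of_ae_abs_le ((hS n).pow_const 2) (C := (n * C) ^ 2) ?_
      filter_upwards [ae_abs_sum_range_le hC n] with ω h
      rw [abs_pow]
      exact pow_le_pow_left₀ (abs_nonneg _) h 2
    have i2 : Integrable (fun ω => (∑ i ∈ Finset.range n, X i ω) * X n ω) μ :=
      integrable_of_ae_abs_le ((hS n).mul (hX n)) (ae_abs_sum_range_mul_le hC n)
    have b3 : ∀ᵐ ω ∂μ, X n ω ^ 2 ≤ C ^ 2 := by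
      filter_upwards [hC n] with ω h
      rw [← sq_abs]
      exact pow_le_pow_left₀ (abs_nonneg _) h 2
    have i3 : Integrable (fun ω => X n ω ^ 2) μ := by
      refine integrable_of_ae_abs_le ((hX n).pow_const 2) (C := C ^ 2) ?_
      filter_upwards [b3] with ω h
      rwa [abs_of_nonneg (sq_nonneg _)]
    have e : ∀ ω, (∑ i ∈ Finset.range (n + 1), X i ω) ^ 2 =
        (∑ i ∈ Finset.range n, X i ω) ^ 2 + 2 * ((∑ i ∈ Finset.range n, X i ω) * X n ω) +
          X n ω ^ 2 := fun ω => by rw [Finset.sum_range_succ]; ring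
    have h3 : ∫ ω, X n ω ^ 2 ∂μ ≤ C ^ 2 := by
      have := integral_mono_ae i3 (integrable_const (C ^ 2)) b3
      simpa using this
    simp only [e]
    have i4 : Integrable (fun ω => (∑ i ∈ Finset.range n, X i ω) ^ 2 +
        2 * ((∑ i ∈ Finset.range n, X i ω) * X n ω)) μ := i1.add (i2.const_mul 2)
    rw [integral_add i4 i3, integral_add i1 (i2.const_mul 2),
      integral_const_mul, horth n]
    push_cast
    linarith

/-- If nonnegative random variables have summable expectations, they tend to `0` almost surely. -/
theorem ae_tendsto_zero_of_summable_integral {f : ℕ → Ω → ℝ} (hf : ∀ n, Integrable (f n) μ)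
    (h0 : ∀ n ω, 0 ≤ f n ω) {b : ℕ → ℝ} (hb : Summable b) (hfb : ∀ n, ∫ ω, f n ω ∂μ ≤ b n) :
    ∀ᵐ ω ∂μ, Tendsto (fun n => f n ω) atTop (𝓝 0) := by
  have hs : ∑' n, ∫⁻ ω, ENNReal.ofReal (f n ω) ∂μ ≠ ⊤ := by
    refine ne_top_of_le_ne_top hb.tsum_ofReal_ne_top (ENNReal.tsum_le_tsum fun n => ?_)
    rw [← ofReal_integral_eq_lintegral_ofReal (hf n) (ae_of_all _ (h0 n))]
    exact ENNReal.ofReal_le_ofReal (hfb n)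
  have hm : ∀ n, AEMeasurable (fun ω => ENNReal.ofReal (f n ω)) μ := fun n =>
    (hf n).aemeasurable.ennreal_ofReal
  rw [← lintegral_tsum hm] at hs
  filter_upwards [ae_lt_top' (AEMeasurable.tsum hm) hs] with ω h
  have h1 := ENNReal.tendsto_atTop_zero_of_tsum_ne_top h.ne
  have h2 := (ENNReal.tendsto_toReal ENNReal.zero_ne_top).comp h1
  refine h2.congr fun n => ?_
  simp [ENNReal.toReal_ofReal (h0 n ω)]

/-- A sequence with bounded increments is sublinear as soon as it is so along the squares. -/
theorem tendsto_div_of_tendsto_div_sq {S : ℕ → ℝ} {C : ℝ} (hS : ∀ n, |S (n + 1) - S n| ≤ C)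
    (h : Tendsto (fun m : ℕ => S (m ^ 2) / (m : ℝ) ^ 2) atTop (𝓝 0)) :
    Tendsto (fun n : ℕ => S n / n) atTop (𝓝 0) := by
  have hC : 0 ≤ C := (abs_nonneg _).trans (hS 0)
  have hdiff : ∀ m k, |S (m + k) - S m| ≤ k * C := by
    intro m k
    induction k with
    | zero => simp
    | succ k ih =>
      have := abs_sub_le (S (m + (k + 1))) (S (m + k)) (S m)
      have := hS (m + k)
      push_cast
      rw [← add_assoc] at *
      linarith
  have hsqrt : Tendsto Nat.sqrt atTop atTop :=
    tendsto_atTop_atTop.mpr fun b => ⟨b ^ 2, fun a ha => Nat.le_sqrt'.mpr ha⟩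
  have h1 : Tendsto (fun m : ℕ => |S (m ^ 2) / (m : ℝ) ^ 2| + 2 * C / (m : ℝ)) atTop (𝓝 0) := by
    simpa using h.abs.add (tendsto_const_div_atTop_nhds_zero_nat (2 * C))
  refine squeeze_zero_norm' ?_ (h1.comp hsqrt)
  filter_upwards [eventually_gt_atTop 0] with n hn
  obtain ⟨m, hm⟩ : ∃ m, m = Nat.sqrt n := ⟨_, rfl⟩
  have hm0 : 0 < m := hm ▸ Nat.sqrt_pos.mpr hn
  have hmR : (0 : ℝ) < m := by exact_mod_cast hm0
  have hmn : m ^ 2 ≤ n := hm ▸ Nat.sqrt_le' n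
  have hnm : n ≤ m ^ 2 + 2 * m := by
    have := Nat.sqrt_le_add n
    rw [← hm] at this
    nlinarith
  obtain ⟨k, rfl⟩ := Nat.exists_eq_add_of_le hmn
  have hk : (k : ℝ) ≤ 2 * m := by exact_mod_cast (by omega : k ≤ 2 * m)
  have h2 : |S (m ^ 2 + k)| ≤ |S (m ^ 2)| + 2 * m * C := by
    have := abs_sub_abs_le_abs_sub (S (m ^ 2 + k)) (S (m ^ 2))
    have := hdiff (m ^ 2) k
    have := mul_le_mul_of_nonneg_right hk hC
    linarith
  have hle : ((m : ℝ) ^ 2) ≤ ((m ^ 2 + k : ℕ) : ℝ) := by exact_mod_cast hmn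
  simp only [Function.comp, ← hm]
  rw [Real.norm_eq_abs, abs_div, abs_div, Nat.abs_cast, abs_of_pos (pow_pos hmR 2)]
  calc |S (m ^ 2 + k)| / ((m ^ 2 + k : ℕ) : ℝ)
      ≤ (|S (m ^ 2)| + 2 * m * C) / (m : ℝ) ^ 2 := by gcongr
    _ = |S (m ^ 2)| / (m : ℝ) ^ 2 + 2 * C / m := by field_simp

/-- Strong law of large numbers for bounded increments, each orthogonal to the sum of the earlier
ones: the second moments of the averages are summable along the squares, and bounded increments
allow interpolation. -/
theorem ae_tendsto_sum_div_of_orthogonal [IsProbabilityMeasure μ] {X : ℕ → Ω → ℝ}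
    (hX : ∀ n, Measurable (X n)) {C : ℝ}
    (hC : ∀ n, ∀ᵐ ω ∂μ, |X n ω| ≤ C)
    (horth : ∀ n, ∫ ω, (∑ i ∈ Finset.range n, X i ω) * X n ω ∂μ = 0) :
    ∀ᵐ ω ∂μ, Tendsto (fun n : ℕ => (∑ i ∈ Finset.range n, X i ω) / n) atTop (𝓝 0) := by
  set S : ℕ → Ω → ℝ := fun n ω => ∑ i ∈ Finset.range n, X i ω with hSdef
  have hS : ∀ n, Measurable (S n) := fun n => Finset.measurable_fun_sum _ fun i _ => hX i
  have hsum : Summable fun m : ℕ => C ^ 2 * (1 / (m : ℝ) ^ 2) :=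
    (Real.summable_one_div_nat_pow.mpr (by norm_num)).mul_left _
  have hsq : ∀ᵐ ω ∂μ, Tendsto (fun m : ℕ => (S (m ^ 2) ω / (m : ℝ) ^ 2) ^ 2) atTop (𝓝 0) := by
    refine ae_tendsto_zero_of_summable_integral (fun m => ?_) (fun m ω => sq_nonneg _) hsum
      fun m => ?_
    · refine integrable_of_ae_abs_le (((hS _).div_const _).pow_const 2)
        (C := (((m ^ 2 : ℕ) : ℝ) * C / (m : ℝ) ^ 2) ^ 2) ?_
      filter_upwards [ae_abs_sum_range_le hC (m ^ 2)] with ω h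
      rw [abs_pow, abs_div, abs_of_nonneg (by positivity : (0 : ℝ) ≤ (m : ℝ) ^ 2)]
      gcongr
    · have h1 := integral_sq_sum_range_le hX hC horth (m ^ 2)
      simp only [div_pow, integral_div]
      rcases Nat.eq_zero_or_pos m with rfl | hm
      · simp
      have hmR : (0 : ℝ) < m := by exact_mod_cast hm
      calc (∫ ω, S (m ^ 2) ω ^ 2 ∂μ) / ((m : ℝ) ^ 2) ^ 2
          ≤ ((m ^ 2 : ℕ) * C ^ 2) / ((m : ℝ) ^ 2) ^ 2 := by gcongr
        _ = C ^ 2 * (1 / (m : ℝ) ^ 2) := by push_cast; field_simp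
  filter_upwards [hsq, ae_all_iff.mpr hC] with ω h1 h2
  refine tendsto_div_of_tendsto_div_sq (C := C) (fun n => ?_) ?_
  · simpa [hSdef, Finset.sum_range_succ] using h2 n
  · rw [tendsto_zero_iff_abs_tendsto_zero]
    have := h1.sqrt
    simpa [Function.comp_def, Real.sqrt_sq_eq_abs] using this

end StrongLaw

/-! ### Degree counts under the two growth steps -/

namespace Network

theorem inDegree_addNode_castSucc (g : Network) (v : Fin g.numNodes) :
    g.addNode.inDegree (Fin.castSucc v) = g.inDegree v := by
  simp only [inDegree, addNode, Multiset.map_map, Function.comp_def, Prod.map_snd]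
  rw [← Multiset.count_map_eq_count' Fin.castSucc _ (Fin.castSucc_injective _) v,
    Multiset.map_map]
  rfl

theorem inDegree_addNode_last (g : Network) :
    g.addNode.inDegree (Fin.last g.numNodes) = 0 := by
  simp only [inDegree, addNode, Multiset.map_map, Function.comp_def, Prod.map_snd]
  rw [Multiset.count_eq_zero, Multiset.mem_map]
  rintro ⟨x, -, hx⟩
  exact (Fin.castSucc_lt_last _).ne hx

theorem inDegree_addEdge (g : Network) (u v w : Fin g.numNodes) :
    (g.addEdge u v).inDegree w = g.inDegree w + if w = v then 1 else 0 := by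
  simp only [inDegree, addEdge, Multiset.map_cons]
  exact Multiset.count_cons _ _ _

theorem degreeCount_eq_sum (g : Network) (k : ℕ) :
    (g.degreeCount k : ℝ) = ∑ v, if g.inDegree v = k then 1 else 0 := by
  simp [degreeCount]

theorem degreeCount_addNode (g : Network) (k : ℕ) :
    (g.addNode.degreeCount k : ℝ) = g.degreeCount k + if k = 0 then 1 else 0 := by
  rw [degreeCount_eq_sum, degreeCount_eq_sum]
  refine (Fin.sum_univ_castSucc (n := g.numNodes) _).trans ?_
  congr 1
  · exact Finset.sum_congr rfl fun v _ => by rw [inDegree_addNode_castSucc]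
  · rw [inDegree_addNode_last]
    simp only [eq_comm]

theorem degreeCount_addEdge (g : Network) (u v : Fin g.numNodes) (k : ℕ) :
    ((g.addEdge u v).degreeCount k : ℝ) = g.degreeCount k +
      ((if g.inDegree v + 1 = k then 1 else 0) - if g.inDegree v = k then 1 else 0) := by
  rw [degreeCount_eq_sum, degreeCount_eq_sum]
  have h : ∀ w : Fin g.numNodes, (if (g.addEdge u v).inDegree w = k then (1 : ℝ) else 0) =
      (if g.inDegree w = k then 1 else 0) + if w = v then
        ((if g.inDegree v + 1 = k then 1 else 0) - if g.inDegree v = k then 1 else 0) else 0 := by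
    intro w
    rw [inDegree_addEdge]
    by_cases hw : w = v
    · subst hw; simp
    · simp [hw]
  have hsum : ∑ w : Fin g.numNodes, (if (g.addEdge u v).inDegree w = k then (1 : ℝ) else 0) =
      (∑ w : Fin g.numNodes, if g.inDegree w = k then 1 else 0) +
        ((if g.inDegree v + 1 = k then 1 else 0) - if g.inDegree v = k then 1 else 0) := by
    rw [Finset.sum_congr rfl fun w _ => h w, Finset.sum_add_distrib,
      Finset.sum_ite_eq' Finset.univ v, if_pos (Finset.mem_univ v)]
  exact hsum

theorem sum_inDegree (g : Network) : ∑ v, g.inDegree v = g.edges.card := by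
  simp only [inDegree]
  rw [Multiset.sum_count_eq_card (fun a _ => Finset.mem_univ a), Multiset.card_map]

/-- With affine attachment function, the normalizing factor depends only on the numbers of edges
and nodes. -/
theorem totalAttachment_eq (c : ℝ) (g : Network) :
    g.totalAttachment (fun k : ℕ => (k : ℝ) + c) = g.edges.card + c * g.numNodes := by
  simp only [totalAttachment, Finset.sum_add_distrib, ← Nat.cast_sum, sum_inDegree]
  simp [mul_comm]

theorem sum_ite_inDegree_eq (A : ℕ → ℝ) (g : Network) (k : ℕ) :
    (∑ v, A (g.inDegree v) * if g.inDegree v = k then 1 else 0) = A k * g.degreeCount k := by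
  rw [degreeCount_eq_sum, Finset.mul_sum]
  refine Finset.sum_congr rfl fun v _ => ?_
  split_ifs with h
  · rw [h]
  · simp

instance : DiscreteMeasurableSpace Network := ⟨fun _ => trivial⟩

instance : Countable Network :=
  Function.Injective.countable
    (f := fun g : Network => (⟨g.numNodes, g.edges⟩ : Σ n : ℕ, Multiset (Fin n × Fin n))) <| by
    rintro ⟨n, e⟩ ⟨m, f⟩ h
    simpa using h

theorem addNode_ne_addEdge (g : Network) (u v : Fin g.numNodes) : g.addNode ≠ g.addEdge u v :=
  fun h => Nat.succ_ne_self g.numNodes (congrArg numNodes h)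

theorem addEdge_injective (g : Network) :
    Function.Injective fun e : Fin g.numNodes × Fin g.numNodes => g.addEdge e.1 e.2 := by
  rintro ⟨u, v⟩ ⟨u', v'⟩ h
  simpa [addEdge] using h

/-- One of the networks that can arise from `g` in one step: `none` stands for a new node,
`some (u, v)` for a new edge from `u` to `v`. -/
def successor (g : Network) : Option (Fin g.numNodes × Fin g.numNodes) → Network
  | none => g.addNode
  | some e => g.addEdge e.1 e.2

theorem successor_injective (g : Network) : Function.Injective g.successor := by
  rintro (_ | e) (_ | e') h
  · rfl
  · exact absurd h (g.addNode_ne_addEdge _ _)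
  · exact absurd h.symm (g.addNode_ne_addEdge _ _)
  · rw [g.addEdge_injective h]

end Network

/-! ### Conditioning on the past -/

section History

variable {Ω : Type*} {G : ℕ → Ω → Network}

/-- The sequence of networks with given values at times `1, …, t` and arbitrary values elsewhere. -/
def extendPast (t : ℕ) (h : Finset.Icc 1 t → Network) (s : ℕ) : Network :=
  if hs : s ∈ Finset.Icc 1 t then h ⟨s, hs⟩ else Network.initial

theorem history_extendPast (t : ℕ) (h : Finset.Icc 1 t → Network) :
    history G t (extendPast t h) = {ω | (fun s : Finset.Icc 1 t => G s ω) = h} := by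
  ext ω
  simp only [history, Set.mem_ofPred_eq, funext_iff, Subtype.forall]
  refine forall₂_congr fun s hs => ?_
  rw [extendPast, dif_pos hs]

theorem iUnion_history_extendPast (t : ℕ) :
    ⋃ h : Finset.Icc 1 t → Network, history G t (extendPast t h) = Set.univ := by
  simp [history_extendPast, Set.eq_univ_iff_forall]

theorem pairwise_disjoint_history_extendPast (t : ℕ) :
    Pairwise (Function.onFun Disjoint
      fun h : Finset.Icc 1 t → Network => history G t (extendPast t h)) := by
  intro h h' hne
  rw [Function.onFun, Set.disjoint_left]
  intro ω h1 h2
  rw [history_extendPast] at h1 h2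
  exact hne (h1.symm.trans h2)

variable [MeasurableSpace Ω] {μ : Measure Ω} [IsProbabilityMeasure μ]
  {A : ℕ → ℝ} {p : ℕ → ℝ}

theorem measurableSet_history (hG : ∀ t, Measurable (G t)) (t : ℕ) (g : ℕ → Network) :
    MeasurableSet (history G t g) := by
  have : history G t g = ⋂ s ∈ Finset.Icc 1 t, G s ⁻¹' {g s} := by
    ext ω; simp [history]
  rw [this]
  exact Finset.measurableSet_biInter _ fun s _ => hG s (measurableSet_singleton _)

theorem ae_cond_history_iff (hG : ∀ t, Measurable (G t)) {t : ℕ} {g : ℕ → Network}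
    {P : Ω → Prop} :
    (∀ᵐ ω ∂cond μ (history G t g), P ω) ↔ ∀ᵐ ω ∂μ, ω ∈ history G t g → P ω := by
  rw [ProbabilityTheory.cond,
    Measure.ae_ennreal_smul_measure_iff (ENNReal.inv_ne_zero.mpr (measure_ne_top _ _)),
    ae_restrict_iff' (measurableSet_history hG t g)]

/-- Since there are only countably many histories, an event is almost sure if it is so given each
history of positive probability. -/
theorem ae_of_ae_cond_history (hG : ∀ t, Measurable (G t)) (t : ℕ) {P : Ω → Prop}
    (h : ∀ g, μ (history G t g) ≠ 0 → ∀ᵐ ω ∂cond μ (history G t g), P ω) : ∀ᵐ ω ∂μ, P ω := by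
  have h1 : ∀ᵐ ω ∂μ, ∀ i : Finset.Icc 1 t → Network, ω ∈ history G t (extendPast t i) → P ω := by
    rw [ae_all_iff]
    intro i
    by_cases h0 : μ (history G t (extendPast t i)) = 0
    · filter_upwards [measure_eq_zero_iff_ae_notMem.mp h0] with ω hω h'
      exact absurd h' hω
    · exact (ae_cond_history_iff hG).mp (h _ h0)
  filter_upwards [h1] with ω hω
  have : ω ∈ ⋃ i : Finset.Icc 1 t → Network, history G t (extendPast t i) := by
    rw [iUnion_history_extendPast]; trivial
  obtain ⟨i, hi⟩ := Set.mem_iUnion.mp this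
  exact hω i hi

/-- The tower property over the countably many histories, for vanishing conditional
expectations. -/
theorem integral_eq_zero_of_cond_history (hG : ∀ t, Measurable (G t)) (t : ℕ) {F : Ω → ℝ}
    (hF : Integrable F μ)
    (h : ∀ g, μ (history G t g) ≠ 0 → ∫ ω, F ω ∂cond μ (history G t g) = 0) :
    ∫ ω, F ω ∂μ = 0 := by
  rw [← setIntegral_univ, ← iUnion_history_extendPast (G := G) t,
    integral_iUnion (fun i => measurableSet_history hG t _)
      (pairwise_disjoint_history_extendPast t) hF.integrableOn]
  refine (tsum_congr fun i => ?_).trans tsum_zero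
  by_cases h0 : μ (history G t (extendPast t i)) = 0
  · exact setIntegral_measure_zero _ h0
  · have h1 := h _ h0
    rw [ProbabilityTheory.cond, integral_smul_measure, smul_eq_mul, mul_eq_zero] at h1
    refine h1.resolve_left ?_
    rw [ENNReal.toReal_inv, inv_eq_zero]
    exact (ENNReal.toReal_pos h0 (measure_ne_top _ _)).ne'

/-- Given the past, the next network is almost surely one of the finitely many successors, and the
conditional expectation of a function of it is the corresponding finite sum. -/
theorem cond_step (hG : IsProcess μ A p G) (hA : ∀ k, 0 < A k) {t : ℕ} (ht : 1 ≤ t)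
    {g : ℕ → Network} (hg : μ (history G t g) ≠ 0) :
    ∃ q : Fin (g t).numNodes → ℝ, ∑ u, q u = 1 ∧ 0 < (g t).totalAttachment A ∧
      (∀ᵐ ω ∂cond μ (history G t g), ∃ e, G (t + 1) ω = (g t).successor e) ∧
      ∀ f : Network → ℝ, ∫ ω, f (G (t + 1) ω) ∂cond μ (history G t g) =
        p t * f (g t).addNode + (1 - p t) * ∑ u, ∑ v, q u *
          (A ((g t).inDegree v) / (g t).totalAttachment A) * f ((g t).addEdge u v) := by
  obtain ⟨q, hq⟩ := hG.edge_step t ht g hg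
  have hnode := hG.node_step t ht g hg
  set ν := cond μ (history G t g) with hν
  have hνp : IsProbabilityMeasure ν := cond_isProbabilityMeasure hg
  have hq1 : ∑ u, (q u).toReal = 1 := by
    rw [← ENNReal.toReal_sum fun u _ => q.apply_ne_top u,
      (tsum_fintype (fun u => q u)).symm.trans q.tsum_coe, ENNReal.toReal_one]
  -- the source distribution lives on the nodes, so there is at least one node
  have hne : Nonempty (Fin (g t).numNodes) := ⟨q.support_nonempty.some⟩
  have hW : 0 < (g t).totalAttachment A :=
    Finset.sum_pos (fun v _ => hA _) Finset.univ_nonempty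
  have hms : ∀ e, MeasurableSet (G (t + 1) ⁻¹' {(g t).successor e}) := fun e =>
    hG.measurable _ (measurableSet_singleton _)
  have hdisj : Pairwise (Function.onFun Disjoint
      fun e => G (t + 1) ⁻¹' {(g t).successor e}) := fun e e' hee =>
    Disjoint.preimage _ (by simpa using fun h => hee ((g t).successor_injective h))
  have htotal : ν.real (⋃ e, G (t + 1) ⁻¹' {(g t).successor e}) = 1 := by
    have hU : (⋃ e, G (t + 1) ⁻¹' {(g t).successor e}) =
        ⋃ e ∈ Finset.univ, G (t + 1) ⁻¹' {(g t).successor e} := by simp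
    rw [hU, measureReal_biUnion_finset (fun e _ e' _ h => hdisj h) fun e _ => hms e,
      Fintype.sum_option, Fintype.sum_prod_type]
    have h1 : ν.real (G (t + 1) ⁻¹' {(g t).successor none}) = p t := hnode
    have h2 : ∀ u v, ν.real (G (t + 1) ⁻¹' {(g t).successor (some (u, v))}) =
      (1 - p t) * ((q u).toReal * (A ((g t).inDegree v) / (g t).totalAttachment A)) := hq
    simp only [h1, h2, ← Finset.mul_sum, ← Finset.sum_mul, hq1, ← Finset.sum_div]
    rw [show ∑ v, A ((g t).inDegree v) = (g t).totalAttachment A from rfl, div_self hW.ne']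
    ring
  have hae : ∀ᵐ ω ∂ν, ω ∈ ⋃ e, G (t + 1) ⁻¹' {(g t).successor e} := by
    refine (mem_ae_iff_prob_eq_one (MeasurableSet.iUnion hms)).mpr ?_
    rwa [measureReal_def, ENNReal.toReal_eq_one_iff] at htotal
  refine ⟨fun u => (q u).toReal, hq1, hW, ?_, fun f => ?_⟩
  · filter_upwards [hae] with ω h
    simpa using h
  · have h1 : ∫ ω, f (G (t + 1) ω) ∂ν =
        ∫ ω in ⋃ e, G (t + 1) ⁻¹' {(g t).successor e}, f (G (t + 1) ω) ∂ν := by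
      rw [Measure.restrict_eq_self_of_ae_mem hae]
    have h2 : ∀ e, Set.EqOn (fun ω => f (G (t + 1) ω)) (fun _ => f ((g t).successor e))
        (G (t + 1) ⁻¹' {(g t).successor e}) := fun e ω hω => by
      simp only [Set.mem_preimage, Set.mem_singleton_iff] at hω
      simp only [hω]
    have h3 : ∀ e, ∫ ω in G (t + 1) ⁻¹' {(g t).successor e}, f (G (t + 1) ω) ∂ν =
        ν.real (G (t + 1) ⁻¹' {(g t).successor e}) * f ((g t).successor e) := fun e => by
      rw [setIntegral_congr_fun (hms e) (h2 e), setIntegral_const, smul_eq_mul]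
    rw [h1, integral_iUnion_fintype hms hdisj fun e =>
      (integrableOn_const (C := f ((g t).successor e))).congr_fun (h2 e).symm (hms e)]
    simp only [h3]
    rw [Fintype.sum_option, Fintype.sum_prod_type, Finset.mul_sum]
    congr 1
    · exact congrArg (· * _) hnode
    · refine Finset.sum_congr rfl fun u _ => ?_
      rw [Finset.mul_sum]
      refine Finset.sum_congr rfl fun v _ => ?_
      rw [show ν.real (G (t + 1) ⁻¹' {(g t).successor (some (u, v))}) = _ from hq u v]
      simp only [Network.successor]
      ring

end History

/-! ### Fluctuations around the conditional drift -/

/-- The conditional expectation, given the present network `g` at time `t`, of the change in one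
step of a quantity that changes by `a` if a node is added and by `e g v` if an edge to `v` is
added. -/
noncomputable def drift (A p : ℕ → ℝ) (a : ℝ) (e : ∀ g : Network, Fin g.numNodes → ℝ) (t : ℕ)
    (g : Network) : ℝ :=
  p t * a + (1 - p t) * ∑ v, A (g.inDegree v) / g.totalAttachment A * e g v

theorem abs_drift_le {A p : ℕ → ℝ} {a : ℝ} {e : ∀ g : Network, Fin g.numNodes → ℝ} {t : ℕ}
    {g : Network} (hA : ∀ k, 0 < A k) (hp0 : 0 ≤ p t) (hp1 : p t ≤ 1) (ha : |a| ≤ 1)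
    (he : ∀ v, |e g v| ≤ 1) (hW : 0 < g.totalAttachment A) : |drift A p a e t g| ≤ 1 := by
  have h1 : |∑ v, A (g.inDegree v) / g.totalAttachment A * e g v| ≤ 1 := by
    calc |∑ v, A (g.inDegree v) / g.totalAttachment A * e g v|
        ≤ ∑ v, |A (g.inDegree v) / g.totalAttachment A * e g v| := Finset.abs_sum_le_sum_abs _ _
      _ ≤ ∑ v, A (g.inDegree v) / g.totalAttachment A := by
          refine Finset.sum_le_sum fun v _ => ?_
          have h0 : 0 ≤ A (g.inDegree v) / g.totalAttachment A := div_nonneg (hA _).le hW.le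
          rw [abs_mul, abs_of_nonneg h0]
          exact mul_le_of_le_one_right h0 (he v)
      _ = 1 := by
          rw [← Finset.sum_div]
          exact div_self hW.ne'
  rw [drift]
  refine (abs_add_le _ _).trans ?_
  rw [abs_mul, abs_mul, abs_of_nonneg hp0, abs_of_nonneg (sub_nonneg.mpr hp1)]
  nlinarith [mul_le_mul_of_nonneg_left ha hp0,
    mul_le_mul_of_nonneg_left h1 (sub_nonneg.mpr hp1)]

section Fluctuations

variable {Ω : Type*} [MeasurableSpace Ω] {μ : Measure Ω} [IsProbabilityMeasure μ]
  {A : ℕ → ℝ} {p : ℕ → ℝ} {G : ℕ → Ω → Network}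

theorem ae_step (hG : IsProcess μ A p G) (hA : ∀ k, 0 < A k) :
    ∀ᵐ ω ∂μ, ∀ t, 1 ≤ t →
      0 < (G t ω).totalAttachment A ∧ ∃ s, G (t + 1) ω = (G t ω).successor s := by
  refine ae_all_iff.mpr fun t => ?_
  by_cases ht : 1 ≤ t
  swap
  · exact ae_of_all _ fun ω h => absurd h ht
  refine ae_of_ae_cond_history hG.measurable t fun g hg => ?_
  obtain ⟨-, -, hW, hs, -⟩ := cond_step hG hA ht hg
  have hh : ∀ᵐ ω ∂cond μ (history G t g), ω ∈ history G t g :=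
    (ae_cond_history_iff hG.measurable).mpr (ae_of_all _ fun _ => id)
  filter_upwards [hs, hh] with ω h1 h2 _
  rw [h2 t (Finset.mem_Icc.mpr ⟨ht, le_rfl⟩)]
  exact ⟨hW, h1⟩

/-- The accumulated difference between the true changes of a network statistic `f` and their
conditional expectations averages out to zero. -/
theorem ae_tendsto_sum_sub_drift (hG : IsProcess μ A p G) (hA : ∀ k, 0 < A k)
    (hp : ∀ t, 1 ≤ t → 0 < p t ∧ p t < 1) {f : Network → ℝ} {a : ℝ}
    {e : ∀ g : Network, Fin g.numNodes → ℝ} (hfa : ∀ g, f g.addNode = f g + a)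
    (hfe : ∀ g u v, f (g.addEdge u v) = f g + e g v) (ha : |a| ≤ 1) (he : ∀ g v, |e g v| ≤ 1) :
    ∀ᵐ ω ∂μ, Tendsto (fun n : ℕ => (∑ i ∈ Finset.range n, (f (G (i + 2) ω) - f (G (i + 1) ω) -
      drift A p a e (i + 1) (G (i + 1) ω))) / n) atTop (𝓝 0) := by
  set X : ℕ → Ω → ℝ := fun i ω => f (G (i + 2) ω) - f (G (i + 1) ω) -
      drift A p a e (i + 1) (G (i + 1) ω) with hXdef
  have hcomp : ∀ (h : Network → ℝ) t, Measurable fun ω => h (G t ω) := fun h t =>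
    (measurable_of_countable h).comp (hG.measurable t)
  have hX : ∀ n, Measurable (X n) := fun n => ((hcomp f _).sub (hcomp f _)).sub (hcomp _ _)
  have hC : ∀ n, ∀ᵐ ω ∂μ, |X n ω| ≤ 2 := by
    intro n
    filter_upwards [ae_step hG hA] with ω hω
    obtain ⟨hW, s, hs⟩ := hω (n + 1) (by omega)
    have hd := abs_drift_le hA (hp (n + 1) (by omega)).1.le (hp (n + 1) (by omega)).2.le ha
      (he (G (n + 1) ω)) hW
    have hi : |f (G (n + 2) ω) - f (G (n + 1) ω)| ≤ 1 := by
      rw [hs]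
      rcases s with _ | ⟨u, v⟩
      · simpa only [Network.successor, hfa, add_sub_cancel_left] using ha
      · simpa only [Network.successor, hfe, add_sub_cancel_left] using he _ v
    refine (abs_sub _ _).trans ?_
    linarith
  refine ae_tendsto_sum_div_of_orthogonal hX hC fun n => ?_
  have hint : Integrable (fun ω => (∑ i ∈ Finset.range n, X i ω) * X n ω) μ :=
    integrable_of_ae_abs_le ((Finset.measurable_fun_sum _ fun i _ => hX i).mul (hX n))
      (ae_abs_sum_range_mul_le hC n)
  refine integral_eq_zero_of_cond_history hG.measurable (n + 1) hint fun g hg => ?_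
  obtain ⟨q, hq, hW, -, hf⟩ := cond_step hG hA (by omega) hg
  -- given the past, the partial sum is a constant, and the last increment is a function of the
  -- next network
  set σ : ℝ := ∑ i ∈ Finset.range n, (f (g (i + 2)) - f (g (i + 1)) -
    drift A p a e (i + 1) (g (i + 1))) with hσ
  have hcongr : (fun ω => (∑ i ∈ Finset.range n, X i ω) * X n ω) =ᵐ[cond μ (history G (n + 1) g)]
      fun ω => σ * (f (G (n + 1 + 1) ω) - f (g (n + 1)) -
        drift A p a e (n + 1) (g (n + 1))) := by
    refine (ae_cond_history_iff hG.measurable).mpr (ae_of_all _ fun ω hω => ?_)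
    have hgi : ∀ i, 1 ≤ i → i ≤ n + 1 → G i ω = g i := fun i h1 h2 =>
      hω i (Finset.mem_Icc.mpr ⟨h1, h2⟩)
    simp only [hXdef, hσ, hgi (n + 1) (by omega) le_rfl]
    congr 1
    refine Finset.sum_congr rfl fun i hi => ?_
    have := Finset.mem_range.mp hi
    rw [hgi (i + 2) (by omega) (by omega), hgi (i + 1) (by omega) (by omega)]
  rw [integral_congr_ae hcongr,
    hf fun x => σ * (f x - f (g (n + 1)) - drift A p a e (n + 1) (g (n + 1)))]
  set d := drift A p a e (n + 1) (g (n + 1)) with hd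
  set r : Fin (g (n + 1)).numNodes → ℝ := fun v =>
    A ((g (n + 1)).inDegree v) / (g (n + 1)).totalAttachment A with hr
  have hr1 : ∑ v, r v = 1 := by
    simp only [hr, ← Finset.sum_div]
    exact div_self hW.ne'
  have hd' : d = p (n + 1) * a + (1 - p (n + 1)) * ∑ v, r v * e (g (n + 1)) v := rfl
  have hsum : ∑ u, ∑ v, q u * r v * (σ * (f ((g (n + 1)).addEdge u v) - f (g (n + 1)) - d)) =
      σ * (∑ v, r v * e (g (n + 1)) v - d) := by
    have h1 : ∀ u v, q u * r v * (σ * (f ((g (n + 1)).addEdge u v) - f (g (n + 1)) - d)) =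
        q u * (σ * (r v * e (g (n + 1)) v - r v * d)) := fun u v => by rw [hfe]; ring
    simp only [h1, ← Finset.mul_sum, ← Finset.sum_mul, Finset.sum_sub_distrib, hq, hr1, one_mul]
  rw [hfa, hsum]
  linear_combination -σ * hd'

end Fluctuations

/-! ### Convergence of the node and degree counts -/

/-- The change of `n_k` when an edge to `v` is added. -/
noncomputable def degreeChange (k : ℕ) (g : Network) (v : Fin g.numNodes) : ℝ :=
  (if g.inDegree v + 1 = k then 1 else 0) - if g.inDegree v = k then 1 else 0

theorem abs_degreeChange_le (k : ℕ) (g : Network) (v : Fin g.numNodes) :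
    |degreeChange k g v| ≤ 1 := by
  unfold degreeChange
  split_ifs <;> norm_num

theorem drift_degreeChange_zero (A p : ℕ → ℝ) (t : ℕ) (g : Network) :
    drift A p 1 (degreeChange 0) t g =
      p t - (1 - p t) * (A 0 * g.degreeCount 0 / g.totalAttachment A) := by
  rw [← Network.sum_ite_inDegree_eq, Finset.sum_div, drift, mul_one, sub_eq_add_neg (p t),
    ← mul_neg, ← Finset.sum_neg_distrib]
  congr 2
  refine Finset.sum_congr rfl fun v _ => ?_
  simp only [degreeChange, Nat.add_eq_zero_iff, one_ne_zero, and_false, if_false]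
  ring

theorem drift_degreeChange_succ (A p : ℕ → ℝ) (k t : ℕ) (g : Network) :
    drift A p 0 (degreeChange (k + 1)) t g =
      (1 - p t) * (A k * g.degreeCount k / g.totalAttachment A) -
        (1 - p t) * (A (k + 1) * g.degreeCount (k + 1) / g.totalAttachment A) := by
  rw [← Network.sum_ite_inDegree_eq, ← Network.sum_ite_inDegree_eq, Finset.sum_div,
    Finset.sum_div, drift, mul_zero, zero_add, ← mul_sub, ← Finset.sum_sub_distrib]
  congr 1
  refine Finset.sum_congr rfl fun v _ => ?_
  simp only [degreeChange, Nat.add_right_cancel_iff]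
  ring

section Convergence

variable {Ω : Type*} [MeasurableSpace Ω] {μ : Measure Ω} [IsProbabilityMeasure μ]
  {c p : ℝ} {pt : ℕ → ℝ} {G : ℕ → Ω → Network}

theorem ae_tendsto_numNodes (hc : 0 < c) (hpt : ∀ t, 1 ≤ t → 0 < pt t ∧ pt t < 1)
    (hlim : Tendsto pt atTop (𝓝 p)) (hG : IsProcess μ (fun k : ℕ => (k : ℝ) + c) pt G) :
    ∀ᵐ ω ∂μ, Tendsto (fun n : ℕ => ((G (n + 1) ω).numNodes : ℝ) / (n + 1)) atTop (𝓝 p) := by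
  filter_upwards [ae_tendsto_sum_sub_drift hG (fun k => by positivity) hpt
    (f := fun g => (g.numNodes : ℝ)) (a := 1) (e := fun _ _ => 0)
    (fun g => by simp [Network.addNode]) (fun g u v => by simp [Network.addEdge])
    (by simp) (by simp)] with ω h
  have := tendsto_div_of_recursion (u := fun n => ((G (n + 1) ω).numNodes : ℝ))
    (α := fun n => pt (n + 1)) (β := fun _ => 0) (fun n => ?_)
    ((tendsto_add_atTop_iff_nat 1).mpr hlim) tendsto_const_nhds (fun _ => le_rfl) h
  · simpa using this
  · simp only [drift]
    simp

/-- Every step adds a node or an edge. -/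
theorem ae_card_edges_add_numNodes (hc : 0 < c)
    (hG : IsProcess μ (fun k : ℕ => (k : ℝ) + c) pt G) :
    ∀ᵐ ω ∂μ, ∀ n, (G (n + 1) ω).edges.card + (G (n + 1) ω).numNodes = n + 2 := by
  filter_upwards [hG.start, ae_step hG fun k => by positivity] with ω h1 hs n
  induction n with
  | zero => rw [zero_add, h1]; rfl
  | succ n ih =>
    obtain ⟨-, s, hs⟩ := hs (n + 1) (by omega)
    rw [hs]
    rcases s with _ | ⟨u, v⟩
    · simp only [Network.successor, Network.addNode, Multiset.card_map]
      omega
    · simp only [Network.successor, Network.addEdge, Multiset.card_cons]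
      omega

theorem ae_tendsto_totalAttachment (hc : 0 < c) (hp1 : p < 1)
    (hpt : ∀ t, 1 ≤ t → 0 < pt t ∧ pt t < 1) (hlim : Tendsto pt atTop (𝓝 p))
    (hG : IsProcess μ (fun k : ℕ => (k : ℝ) + c) pt G) :
    ∀ᵐ ω ∂μ, Tendsto (fun n : ℕ => (G (n + 1) ω).totalAttachment (fun k : ℕ => (k : ℝ) + c) /
      (n + 1)) atTop (𝓝 ((1 - p) * rate p c)) := by
  filter_upwards [ae_tendsto_numNodes hc hpt hlim hG, ae_card_edges_add_numNodes hc hG]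
    with ω hN hE
  have h1 : Tendsto (fun n : ℕ => (1 : ℝ) + 1 / (n + 1) + (c - 1) *
      (((G (n + 1) ω).numNodes : ℝ) / (n + 1))) atTop (𝓝 (1 + 0 + (c - 1) * p)) :=
    (tendsto_one_div_add_atTop_nhds_zero_nat.const_add 1).add (hN.const_mul _)
  have h2 : 1 + 0 + (c - 1) * p = (1 - p) * rate p c := by
    have : 1 - p ≠ 0 := by linarith
    unfold rate
    field_simp
    ring
  rw [← h2]
  refine h1.congr fun n => ?_
  have h3 : ((G (n + 1) ω).edges.card : ℝ) + (G (n + 1) ω).numNodes = n + 2 := by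
    exact_mod_cast hE n
  rw [Network.totalAttachment_eq, eq_div_iff (by positivity)]
  field_simp
  linear_combination -h3

/-- The recursion for `n_k`, with the drift split into an inflow `α` and the outflow to in-degree
`k + 1`, forces the linear growth of `n_k`. -/
theorem ae_tendsto_degreeCount_of_inflow (hc : 0 < c) (hp0 : 0 < p) (hp1 : p < 1)
    (hpt : ∀ t, 1 ≤ t → 0 < pt t ∧ pt t < 1) (hlim : Tendsto pt atTop (𝓝 p))
    (hG : IsProcess μ (fun k : ℕ => (k : ℝ) + c) pt G) (k : ℕ) {α : ℕ → Ω → ℝ} {b : ℝ}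
    (hdrift : ∀ n ω, drift (fun k : ℕ => (k : ℝ) + c) pt (if k = 0 then 1 else 0) (degreeChange k)
      (n + 1) (G (n + 1) ω) = α n ω - (1 - pt (n + 1)) * ((k + c) * (G (n + 1) ω).degreeCount k /
        (G (n + 1) ω).totalAttachment (fun k : ℕ => (k : ℝ) + c)))
    (hα : ∀ᵐ ω ∂μ, Tendsto (fun n => α n ω) atTop (𝓝 b)) :
    ∀ᵐ ω ∂μ, Tendsto (fun n : ℕ => ((G (n + 1) ω).degreeCount k : ℝ) / (n + 1)) atTop
      (𝓝 (b / (1 + (k + c) / rate p c))) := by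
  have hl : 0 < rate p c := rate_pos hc hp0 hp1
  have hp1' : 0 < 1 - p := sub_pos.mpr hp1
  filter_upwards [ae_tendsto_sum_sub_drift hG (fun k => by positivity) hpt
    (f := fun g => (g.degreeCount k : ℝ)) (e := degreeChange k)
    (fun g => g.degreeCount_addNode k)
    (fun g u v => g.degreeCount_addEdge u v k) (by split_ifs <;> simp) (abs_degreeChange_le k),
    ae_step hG (fun k => by positivity), hα, ae_tendsto_totalAttachment hc hp1 hpt hlim hG]
    with ω hx hs hα hW
  refine tendsto_div_of_recursion (u := fun n => ((G (n + 1) ω).degreeCount k : ℝ))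
    (β := fun n => (1 - pt (n + 1)) * (k + c) /
      ((G (n + 1) ω).totalAttachment (fun k : ℕ => (k : ℝ) + c) / (n + 1)))
    (fun n => ?_) hα ?_ (fun n => ?_) hx
  · rw [hdrift]
    have : (n : ℝ) + 1 ≠ 0 := by positivity
    have := (hs (n + 1) (by omega)).1.ne'
    field_simp
    ring
  · have h1 := ((((tendsto_add_atTop_iff_nat 1).mpr hlim).const_sub 1).mul_const
      ((k : ℝ) + c)).div hW (by positivity)
    rwa [mul_div_mul_left _ _ hp1'.ne'] at h1
  · have h1 := (hpt (n + 1) (by omega)).2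
    have h2 := (hs (n + 1) (by omega)).1
    have h3 : 0 < 1 - pt (n + 1) := sub_pos.mpr h1
    positivity

/-- Induction on `k`: the inflow to in-degree `k + 1` is the outflow from in-degree `k`. -/
theorem ae_tendsto_degreeCount (hc : 0 < c) (hp0 : 0 < p) (hp1 : p < 1)
    (hpt : ∀ t, 1 ≤ t → 0 < pt t ∧ pt t < 1) (hlim : Tendsto pt atTop (𝓝 p))
    (hG : IsProcess μ (fun k : ℕ => (k : ℝ) + c) pt G) (k : ℕ) :
    ∀ᵐ ω ∂μ, Tendsto (fun n : ℕ => ((G (n + 1) ω).degreeCount k : ℝ) / (n + 1)) atTop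
      (𝓝 (p * limitDegree p c k)) := by
  have hl : 0 < rate p c := rate_pos hc hp0 hp1
  have hp1' : 0 < 1 - p := sub_pos.mpr hp1
  have hlim' := (tendsto_add_atTop_iff_nat 1).mpr hlim
  induction k with
  | zero =>
    have h := ae_tendsto_degreeCount_of_inflow hc hp0 hp1 hpt hlim hG 0
      (α := fun n _ => pt (n + 1)) (fun n ω => ?_) (ae_of_all _ fun _ => hlim')
    · rw [limitDegree_zero_eq hc hp0 hp1]
      simpa using h
    · rw [if_pos rfl, drift_degreeChange_zero]
  | succ k ih =>
    rw [limitDegree_succ_eq hc hp0 hp1]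
    refine ae_tendsto_degreeCount_of_inflow hc hp0 hp1 hpt hlim hG (k + 1)
      (α := fun n ω => (1 - pt (n + 1)) * ((k + c) * (G (n + 1) ω).degreeCount k /
        (G (n + 1) ω).totalAttachment (fun k : ℕ => (k : ℝ) + c))) (fun n ω => ?_) ?_
    · rw [if_neg k.succ_ne_zero, drift_degreeChange_succ]
    · filter_upwards [ih, ae_tendsto_totalAttachment hc hp1 hpt hlim hG] with ω h1 h2
      have h3 := (hlim'.const_sub 1).mul ((h1.const_mul ((k : ℝ) + c)).div h2 (by positivity))
      have h4 : (1 - p) * ((k + c) * (p * limitDegree p c k) / ((1 - p) * rate p c)) =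
          (k + c) / rate p c * (p * limitDegree p c k) := by field_simp
      rw [h4] at h3
      refine h3.congr fun n => ?_
      have : (n : ℝ) + 1 ≠ 0 := by positivity
      simp only [Pi.div_apply]
      rw [← mul_div_assoc ((k : ℝ) + c) _ ((n : ℝ) + 1), div_div_div_cancel_right₀ this]

end Convergence

theorem tendsto_of_isBigO_rpow_mul_log {p : ℝ} {pt : ℕ → ℝ}
    (hpO : (fun t : ℕ => pt t - p) =O[atTop]
      fun t : ℕ => (t : ℝ) ^ (-(1 / 2) : ℝ) * Real.log (t : ℝ)) : Tendsto pt atTop (𝓝 p) := by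
  have h1 : Tendsto (fun x : ℝ => x ^ (-(1 / 2) : ℝ) * Real.log x) atTop (𝓝 0) := by
    have := (isLittleO_log_rpow_atTop (by norm_num : (0 : ℝ) < 1 / 2)).tendsto_div_nhds_zero
    refine this.congr' ?_
    filter_upwards [eventually_gt_atTop 0] with x hx
    rw [Real.rpow_neg hx.le, div_eq_inv_mul]
  have h2 := hpO.trans_tendsto (h1.comp tendsto_natCast_atTop_atTop)
  simpa using h2.add_const p

end SimpleGrowth

theorem proposition1 {Ω : Type*} [MeasurableSpace Ω] (μ : Measure Ω) [IsProbabilityMeasure μ]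
    (c : ℝ) (hc : 0 < c) (p : ℝ) (hp0 : 0 < p) (hp1 : p < 1)
    (pt : ℕ → ℝ) (hpt : ∀ t, 1 ≤ t → 0 < pt t ∧ pt t < 1)
    (hpO : (fun t : ℕ => pt t - p) =O[atTop]
      fun t : ℕ => (t : ℝ) ^ (-(1 / 2) : ℝ) * Real.log (t : ℝ))
    (G : ℕ → Ω → SimpleGrowth.Network)
    (hG : SimpleGrowth.IsProcess μ (fun k : ℕ => (k : ℝ) + c) pt G) :
    -- almost sure convergence of `n_k(t) / (p t)`
    (∀ k : ℕ, ∀ᵐ ω ∂μ,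
      Tendsto (fun t : ℕ => ((G t ω).degreeCount k : ℝ) / (p * (t : ℝ))) atTop
        (𝓝 (SimpleGrowth.limitDegree p c k))) ∧
    -- almost sure convergence of the proportion of nodes of in-degree `k`
    (∀ k : ℕ, ∀ᵐ ω ∂μ,
      Tendsto (fun t : ℕ => ((G t ω).degreeCount k : ℝ) / ((G t ω).numNodes : ℝ)) atTop
        (𝓝 (SimpleGrowth.limitDegree p c k))) ∧
    -- the limits form a probability distribution on `ℕ`
    (∀ k : ℕ, 0 ≤ SimpleGrowth.limitDegree p c k) ∧
    HasSum (SimpleGrowth.limitDegree p c) 1 ∧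
    -- power-law tail with exponent `1 + λ`
    Tendsto (fun k : ℕ => SimpleGrowth.limitDegree p c k /
        (k : ℝ) ^ (-(1 + SimpleGrowth.rate p c))) atTop
      (𝓝 (SimpleGrowth.rate p c * Real.Gamma (SimpleGrowth.rate p c + c) / Real.Gamma c)) := by

  have hlim := SimpleGrowth.tendsto_of_isBigO_rpow_mul_log hpO
  have hdeg : ∀ k : ℕ, ∀ᵐ ω ∂μ,
      Tendsto (fun t : ℕ => ((G t ω).degreeCount k : ℝ) / (p * (t : ℝ))) atTop
        (𝓝 (SimpleGrowth.limitDegree p c k)) := fun k => by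
    filter_upwards [SimpleGrowth.ae_tendsto_degreeCount hc hp0 hp1 hpt hlim hG k] with ω h
    rw [← tendsto_add_atTop_iff_nat 1]
    have h1 := h.div_const p
    rw [mul_div_cancel_left₀ _ hp0.ne'] at h1
    refine h1.congr fun n => ?_
    push_cast
    rw [div_div, mul_comm p]
  have hnodes : ∀ᵐ ω ∂μ,
      Tendsto (fun t : ℕ => ((G t ω).numNodes : ℝ) / (p * (t : ℝ))) atTop (𝓝 1) := by
    filter_upwards [SimpleGrowth.ae_tendsto_numNodes hc hpt hlim hG] with ω h
    rw [← tendsto_add_atTop_iff_nat 1]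
    have h1 := h.div_const p
    rw [div_self hp0.ne'] at h1
    refine h1.congr fun n => ?_
    push_cast
    rw [div_div, mul_comm p]
  refine ⟨hdeg, fun k => ?_, SimpleGrowth.limitDegree_nonneg hc hp0 hp1,
    SimpleGrowth.hasSum_limitDegree hc hp0 hp1,
    SimpleGrowth.tendsto_limitDegree_div_rpow hc hp0 hp1⟩
  filter_upwards [hdeg k, hnodes] with ω h1 h2
  have h3 := h1.div h2 one_ne_zero
  rw [div_one] at h3
  refine h3.congr' ?_
  filter_upwards [eventually_gt_atTop 0] with t ht
  have : (t : ℝ) ≠ 0 := by exact_mod_cast ht.ne'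
  exact div_div_div_cancel_right₀ (mul_ne_zero hp0.ne' this) _ _
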